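/- Let $p$ be an odd prime and let $m, r_1,\dots,r_t$ be positive integers such that $r=\sum_{j=1}^t r_j\ge 4$ is even, $m\le r/2$, and $m\mid r_j$ for all $j$. Let $V_r=\mathbb{F}_{p^{r_1}}\times\cdots\times\mathbb{F}_{p^{r_t}}$, write $V_r^*=V_r\setminus\{0\}$, let $Tr^{b}_{a}$ denote the trace from $\mathbb{F}_{p^b}$ to $\mathbb{F}_{p^a}$, and let $\zeta_p=e^{2\pi i/p}$. For $f:V_r\to\mathbb{F}_p$ let $W_f(a)=\sum_{x\in V_r}\zeta_p^{f(x)-\sum_j Tr^{r_j}_1(a_jx_j)}$; $f$ is bent if $|W_f(a)|=p^{r/2}$ for all $a\in V_r$. A map $F:V_r\to\mathbb{F}_{p^m}$ is vectorial bent if all $F_c(x)=Tr^m_1(cF(x))$, $c\in\mathbb{F}_{p^m}^*$, are bent. Let $F:V_r\to\mathbb{F}_{p^m}$ be vectorial bent with $F(0)=0$ and $F(-x)=F(x)$. Assume that there are a sign $\varepsilon\in\{1,-1\}$, a vectorial bent function $F^*:V_r\to\mathbb{F}_{p^m}$ and a positive integer $e$ with $\gcd(e,p^m-1)=1$ such that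 $W_{F_c}(a)=\varepsilon p^{r/2}\zeta_p^{(F^*)_{\sigma(c)}(a)}$ with $\sigma(c)=c^{-e}$, and $F^*(cx)=c^{e+1}F^*(x)$, for all $c\in\mathbb{F}_{p^m}^*$ and $a,x\in V_r$. Let $s$ be a positive divisor of $m$ with $s\le \frac r2-1$, and let $\mathcal{C}_F\subseteq\mathbb{F}_{p^s}^{V_r^*}$ be the $p^s$-ary linear code consisting of all words $c_{\alpha,\beta}=\bigl(Tr^m_s(\alpha F(x))-\sum_{j=1}^t Tr^{r_j}_s(\beta_jx_j)\bigr)_{x\in V_r^*}$, $\alpha\in\mathbb{F}_{p^m}$, $\beta\in V_r$. Then: 1. $\mathcal{C}_F$ is minimal: if $u,v\in\mathcal{C}_F$, $u\ne0$ and $\mathrm{supp}(v)\subseteq\mathrm{supp}(u)$, then $v$ is a scalar multiple of $u$. 2. The dual code $\mathcal{C}_F^\perp$ has minimum distance at least $2$, and exactly $2$ unless $\varepsilon=-1$ and $m=\frac r2$. 3. Order $V_r^*$ in any way, and let $G=[g_0,g_1,\dots,g_{p^r-2}]$ be any generator matrix of $\mathcal{C}_F$, with columns indexed accordingly. Consider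 the secret sharing scheme based on $\mathcal{C}_F^\perp$: for a generator matrix $H=[h_0,\dots,h_{p^r-2}]$ of $\mathcal{C}_F^\perp$ and a random vector $u$ over $\mathbb{F}_{p^s}$, the secret is $uh_0$ and participant $P_i$ ($1\le i\le p^r-2$) gets the share $uh_i$. An access set is a set of participants whose shares determine the secret, and it is minimal if no proper subset of it is an access set. Then there are exactly $p^{r+m-s}$ minimal access sets. For every $1\le i\le p^r-2$, if $g_i$ is a scalar multiple of $g_0$, then $P_i$ belongs to all minimal access sets; if not, then $P_i$ belongs to exactly $(p^s-1)p^{r+m-2s}$ of them. -/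

import Mathlib

noncomputable section

namespace VDBCode

/-! ### Bent functions on `V = E 0 × ⋯ × E (t-1)`, a product of finite fields of characteristic `p` -/

section Bent

variable (p : ℕ) [Fact p.Prime] {t : ℕ} {E : Fin t → Type*} [∀ j, Field (E j)]
  [∀ j, Fintype (E j)] [∀ j, Algebra (ZMod p) (E j)]

/-- The inner product `⟨a, x⟩ = ∑ j, Tr (a_j x_j)` on `V`, with the absolute traces. -/
def innerProd (a x : ∀ j, E j) : ZMod p :=
  ∑ j, Algebra.trace (ZMod p) (E j) (a j * x j)

/-- The Walsh transform `W_f(a) = ∑ x, ζ_p ^ (f x - ⟨a, x⟩)`;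
`ZMod.stdAddChar j` is `exp (2 π i j / p)`. -/
def walsh (f : (∀ j, E j) → ZMod p) (a : ∀ j, E j) : ℂ :=
  ∑ x : ∀ j, E j, (ZMod.stdAddChar (f x - innerProd p a x) : ℂ)

/-- `p ^ (r / 2)`, the square root of `|V| = p ^ r`. -/
def sqrtCard (E : Fin t → Type*) [∀ j, Fintype (E j)] : ℝ :=
  Real.sqrt (Fintype.card (∀ j, E j))

/-- `f : V → 𝔽_p` is bent if `|W_f(a)| = p ^ (r / 2)` for all `a`. -/
def IsBent (f : (∀ j, E j) → ZMod p) : Prop :=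
  ∀ a, ‖walsh p f a‖ = sqrtCard E

/-- `g` is the dual `f^*` of the bent function `f : V → 𝔽_p`: for all `a`,
`W_f(a) = ± p^(r/2) ζ_p^(g a)` if `p ≡ 1 mod 4` or `r` is even, and
`W_f(a) = ± i p^(r/2) ζ_p^(g a)` otherwise, where `r = dim V`. -/
def IsDual (f g : (∀ j, E j) → ZMod p) : Prop :=
  ∀ a, ∃ u : ℂ,
    (if p % 4 = 1 ∨ Even (Module.finrank (ZMod p) (∀ j, E j))
      then u = 1 ∨ u = -1 else u = Complex.I ∨ u = -Complex.I) ∧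
    walsh p f a = u * (sqrtCard E : ℂ) * (ZMod.stdAddChar (g a) : ℂ)

/-- `f` is weakly regular with sign `ε` and dual `g`: `W_f(a) = ε p^(r/2) ζ_p^(g a)` for all `a`. -/
def IsWeaklyRegularWith (ε : ℤ) (f g : (∀ j, E j) → ZMod p) : Prop :=
  ∀ a, walsh p f a = (ε : ℂ) * (sqrtCard E : ℂ) * (ZMod.stdAddChar (g a) : ℂ)

variable {L : Type*} [Field L] [Algebra (ZMod p) L]

/-- The component function `F_c(x) = Tr (c F(x))`. -/
def component (F : (∀ j, E j) → L) (c : L) : (∀ j, E j) → ZMod p :=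
  fun x => Algebra.trace (ZMod p) L (c * F x)

/-- `F : V → L` is vectorial bent if all `F_c`, `c ≠ 0`, are bent. -/
def IsVectorialBent (F : (∀ j, E j) → L) : Prop :=
  ∀ c : L, c ≠ 0 → IsBent p (component p F c)

/-- `F` is vectorial dual-bent with vectorial dual `Fstar` and permutation `σ` of `L \ {0}`:
both are vectorial bent, and `(F_c)^* = (Fstar)_{σ(c)}` for all `c ≠ 0`. -/
def IsVectorialDualBent (F Fstar : (∀ j, E j) → L) (σ : Equiv.Perm Lˣ) : Prop :=
  IsVectorialBent p F ∧ IsVectorialBent p Fstar ∧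
    ∀ c : Lˣ, IsDual p (component p F c) (component p Fstar (σ c : L))

/-- Condition A on a function `F : V → L` with sign `ε`, where `|L| = p ^ m`, `|E j| = p ^ (r j)`:
the restrictions on `p`, `m` and the `r j`, and the restrictions on `F`. -/
structure ConditionA [Fintype L] [∀ j, Algebra L (E j)]
    (m : ℕ) (r : Fin t → ℕ) (F : (∀ j, E j) → L) (ε : ℤ) : Prop where
  p_odd : p ≠ 2
  card_L : Fintype.card L = p ^ m
  card_E : ∀ j, Fintype.card (E j) = p ^ r j
  m_pos : 0 < m
  r_pos : ∀ j, 0 < r j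
  four_le : 4 ≤ ∑ j, r j
  even_r : Even (∑ j, r j)
  m_le : m ≤ (∑ j, r j) / 2
  m_dvd : ∀ j, m ∣ r j
  map_zero : F 0 = 0
  map_neg : ∀ x, F (-x) = F x
  sign : ε = 1 ∨ ε = -1
  dual : ∃ (Fstar : (∀ j, E j) → L) (e : ℕ) (σ : Equiv.Perm Lˣ),
    0 < e ∧ Nat.Coprime e (p ^ m - 1) ∧
    (∀ c : Lˣ, σ c = (c⁻¹) ^ e) ∧
    IsVectorialDualBent p F Fstar σ ∧
    (∀ c : Lˣ, IsWeaklyRegularWith p ε (component p F c) (component p Fstar (σ c : L))) ∧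
    (∀ (c : L) (x : ∀ j, E j), c ≠ 0 → Fstar (c • x) = c ^ (e + 1) * Fstar x)

end Bent

/-! ### The code `C_F` -/

section Code

variable (K : Type*) [Field K] {L : Type*} [Field L] [Algebra K L]
  {t : ℕ} {E : Fin t → Type*} [∀ j, Field (E j)] [∀ j, Algebra K (E j)]

/-- The word `c_{α,β}`, with coordinates indexed by the nonzero vectors `x` of `V`. -/
def codeword (F : (∀ j, E j) → L) (α : L) (β : ∀ j, E j) :
    {x : ∀ j, E j // x ≠ 0} → K :=
  fun x => Algebra.trace K L (α * F x.1) - ∑ j, Algebra.trace K (E j) (β j * x.1 j)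

/-- The linear code `C_F = {c_{α,β}}`. -/
def codeCF (F : (∀ j, E j) → L) : Submodule K ({x : ∀ j, E j // x ≠ 0} → K) where
  carrier := {c | ∃ (α : L) (β : ∀ j, E j), c = codeword K F α β}
  zero_mem' := ⟨0, 0, by ext x; simp [codeword]⟩
  add_mem' := by
    rintro _ _ ⟨α, β, rfl⟩ ⟨α', β', rfl⟩
    refine ⟨α + α', β + β', ?_⟩
    ext x
    simp only [codeword, Pi.add_apply, add_mul, map_add, Finset.sum_add_distrib]
    ring
  smul_mem' := by
    rintro a _ ⟨α, β, rfl⟩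
    refine ⟨a • α, a • β, ?_⟩
    ext x
    simp only [codeword, Pi.smul_apply, smul_mul_assoc, map_smul, smul_eq_mul, mul_sub,
      Finset.mul_sum]

end Code

/-! ### Linear codes with coordinates indexed by a finite type -/

section LinearCodes

variable {K : Type*} [Field K] {ι : Type*}

/-- Every nonzero codeword covers only its scalar multiples. -/
def IsMinimalCode (C : Submodule K (ι → K)) : Prop :=
  ∀ u ∈ C, u ≠ 0 → ∀ v ∈ C, Function.support v ⊆ Function.support u → ∃ a : K, v = a • u

/-- The rows of `G` form a basis of `C`. -/
def IsGeneratorMatrix {k : ℕ} (G : Matrix (Fin k) ι K) (C : Submodule K (ι → K)) : Prop :=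
  LinearIndependent K G.row ∧ Submodule.span K (Set.range G.row) = C

variable [Fintype ι]

/-- The dual code for the standard inner product. -/
def dualCode (C : Submodule K (ι → K)) : Submodule K (ι → K) where
  carrier := {u | ∀ v ∈ C, u ⬝ᵥ v = 0}
  zero_mem' := fun v _ => zero_dotProduct v
  add_mem' := fun {a b} ha hb v hv => by rw [add_dotProduct, ha v hv, hb v hv, add_zero]
  smul_mem' := fun c a ha v hv => by rw [smul_dotProduct, ha v hv, smul_zero]

/-- The minimum Hamming distance, as the least weight of a nonzero codeword
(the junk value for the zero code is `0`). -/
def minDist [DecidableEq K] (C : Submodule K (ι → K)) : ℕ :=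
  sInf {w | ∃ c ∈ C, c ≠ 0 ∧ hammingNorm c = w}

end LinearCodes

/-! ### The secret sharing scheme of a linear code with generator matrix `H`

The column with index `i₀` belongs to the dealer, each other index is a participant. A random
vector `u` yields the secret `(u H)_{i₀}` and the shares `(u H)_i`. -/

section SecretSharing

variable {K : Type*} [Field K] {ι : Type*}

/-- A set of participants is an access set if some function of their shares always returns
the secret. -/
def IsAccessSet {k : ℕ} (H : Matrix (Fin k) ι K) (i₀ : ι) (A : Set {i : ι // i ≠ i₀}) : Prop :=
  ∃ rec : (A → K) → K, ∀ u : Fin k → K,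
    rec (fun i => (Matrix.vecMul u H) i.1.1) = Matrix.vecMul u H i₀

/-- The minimal access sets: access sets with no access set as a proper subset. -/
def minimalAccessSets {k : ℕ} (H : Matrix (Fin k) ι K) (i₀ : ι) : Set (Set {i : ι // i ≠ i₀}) :=
  {A | IsAccessSet H i₀ A ∧ ∀ B, B ⊂ A → ¬ IsAccessSet H i₀ B}

end SecretSharing

end VDBCode

end

namespace VDBCode

/-! ### Minimal codes and their secret sharing schemes. -/

section LinearCodes

variable {K : Type*} [Field K] {ι : Type*}

/-! Put `Q = p^(r/2)` and `q = |K|`. By orthogonality of characters, `q` times the number of zeros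
of `c_{α,β}` on `V` is the sum over `z ∈ K` of the Walsh values of `F_{zα}` at `zβ`. The term `z =
0` is `Q²`, the others have modulus at most `Q` by bentness, so every nonzero parameter pair gives
weight between `(q-1)(Q-1)Q/q` and `(q-1)(Q+1)Q/q` (`hammingNorm_codeword_bounds`). Since `s ≤ r/2 -
1` gives `3q ≤ Q`, the Ashikhmin-Barg criterion yields minimality, and `(α,β)` is determined by its
word, so `|C_F| = p^(r+m)`.

No coordinate vanishes on the code, so the dual has no word of weight 1. A zero `y ≠ 0` of the even
function `F` makes `e_y + e_{-y}` a dual word; outside the exceptional case such a `y` exists, by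
counting the zeros of `F` through `Fstar 0`.

Access sets are governed by codewords with value 1 at the dealer (`isAccessSet_iff_exists`). For a
minimal code distinct such words have incomparable supports, so minimal access sets correspond to
them bijectively and are counted as fibers of linear maps. -/

theorem exists_mem_dualCode_of_notMem [Fintype ι] {C : Submodule K (ι → K)} {v : ι → K}
    (hv : v ∉ C) : ∃ d ∈ dualCode C, d ⬝ᵥ v ≠ 0 := by
  classical
  obtain ⟨f, hf, hC⟩ := Submodule.exists_le_ker_of_notMem hv
  obtain ⟨d, rfl⟩ := (dotProductEquiv K ι).surjective f
  exact ⟨d, fun w hw => by simpa using hC hw, by simpa using hf⟩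

theorem IsGeneratorMatrix.range_vecMul {k : ℕ} {G : Matrix (Fin k) ι K}
    {C : Submodule K (ι → K)} (hG : IsGeneratorMatrix G C) (c : ι → K) :
    c ∈ C ↔ ∃ u : Fin k → K, Matrix.vecMul u G = c := by
  rw [← hG.2, Submodule.mem_span_range_iff_exists_fun]
  refine exists_congr fun u => ?_
  rw [Matrix.vecMul_eq_sum]
  rfl

theorem IsGeneratorMatrix.col_eq_smul_iff {k : ℕ} {G : Matrix (Fin k) ι K}
    {C : Submodule K (ι → K)} (hG : IsGeneratorMatrix G C) (x y : ι) (a : K) :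
    G.col x = a • G.col y ↔ ∀ c ∈ C, c x = a * c y := by
  constructor
  · intro h c hc
    obtain ⟨u, rfl⟩ := (hG.range_vecMul c).1 hc
    have h1 : ∀ z, Matrix.vecMul u G z = u ⬝ᵥ G.col z := fun z => rfl
    rw [h1, h1, h, dotProduct_smul, smul_eq_mul]
  · intro h
    ext i
    exact h (G i) (hG.2 ▸ Submodule.subset_span ⟨i, rfl⟩)

/-- By linearity, shares determine the secret exactly when zero shares force a zero secret. -/
theorem isAccessSet_iff_forall {k : ℕ} {H : Matrix (Fin k) ι K} {D : Submodule K (ι → K)}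
    (hH : IsGeneratorMatrix H D) (i₀ : ι) (A : Set {i : ι // i ≠ i₀}) :
    IsAccessSet H i₀ A ↔ ∀ d ∈ D, (∀ i ∈ A, d i.1 = 0) → d i₀ = 0 := by
  constructor
  · rintro ⟨rec, hrec⟩ d hd hA
    obtain ⟨u, rfl⟩ := (hH.range_vecMul d).1 hd
    have h1 := hrec u
    have h0 := hrec 0
    have : (fun i : A => Matrix.vecMul u H i.1.1) = fun i : A => Matrix.vecMul 0 H i.1.1 := by
      funext i
      simpa using hA i.1 i.2
    rw [← h1, this, h0]
    simp
  · intro h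
    classical
    refine ⟨fun w => if hw : ∃ u : Fin k → K, (fun i : A => Matrix.vecMul u H i.1.1) = w
      then Matrix.vecMul hw.choose H i₀ else 0, fun u => ?_⟩
    have hw : ∃ u' : Fin k → K, (fun i : A => Matrix.vecMul u' H i.1.1) =
      fun i : A => Matrix.vecMul u H i.1.1 := ⟨u, rfl⟩
    simp only [dif_pos hw]
    have := h (Matrix.vecMul (hw.choose - u) H) ((hH.range_vecMul _).2 ⟨_, rfl⟩) (by
      intro i hi
      have := congrFun hw.choose_spec ⟨i, hi⟩
      simpa [Matrix.sub_vecMul, sub_eq_zero] using this)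
    simpa [Matrix.sub_vecMul, sub_eq_zero] using this

/-- Massey's correspondence, by duality: a dual word that vanishes on `A` but not at `i₀` is a
functional separating `e_{i₀}` from `C ⊔ S`, where `S` consists of the words supported in `A`. -/
theorem isAccessSet_iff_exists [Fintype ι] {k : ℕ} {H : Matrix (Fin k) ι K}
    {C : Submodule K (ι → K)} (hH : IsGeneratorMatrix H (dualCode C)) (i₀ : ι)
    (A : Set {i : ι // i ≠ i₀}) :
    IsAccessSet H i₀ A ↔ ∃ c ∈ C, c i₀ = 1 ∧ ∀ i : {i : ι // i ≠ i₀}, c i.1 ≠ 0 → i ∈ A := by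
  classical
  rw [isAccessSet_iff_forall hH]
  constructor
  · intro h
    let S : Submodule K (ι → K) :=
      { carrier := {v | v i₀ = 0 ∧ ∀ i : {i : ι // i ≠ i₀}, v i.1 ≠ 0 → i ∈ A}
        zero_mem' := by simp
        add_mem' := by
          rintro a b ⟨ha, ha'⟩ ⟨hb, hb'⟩
          refine ⟨by simp [ha, hb], fun i hi => ?_⟩
          by_contra hiA
          have h1 := not_imp_not.2 (ha' i) hiA
          have h2 := not_imp_not.2 (hb' i) hiA
          push Not at h1 h2
          exact hi (by simp [h1, h2])
        smul_mem' := by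
          rintro c a ⟨ha, ha'⟩
          refine ⟨by simp [ha], fun i hi => ha' i fun h0 => hi (by simp [h0])⟩ }
    have he : Pi.single i₀ (1 : K) ∈ C ⊔ S := by
      by_contra hne
      obtain ⟨d, hd, hd0⟩ := exists_mem_dualCode_of_notMem hne
      refine hd0 ?_
      rw [dotProduct_single_one]
      refine h d (fun v hv => hd v (Submodule.mem_sup_left hv)) fun i hi => ?_
      rw [← dotProduct_single_one d]
      refine hd _ (Submodule.mem_sup_right ⟨by simp [i.2.symm], fun j hj => ?_⟩)
      have : j.1 = i.1 := by
        by_contra hji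
        exact hj (by simp [hji])
      rwa [Subtype.ext this]
    obtain ⟨c, hc, v, ⟨hv0, hv⟩, hcv⟩ := Submodule.mem_sup.1 he
    refine ⟨c, hc, ?_, fun i hi => hv i fun h0 => hi ?_⟩
    · have := congrFun hcv i₀
      simpa [hv0] using this
    · have := congrFun hcv i.1
      simpa [h0, i.2] using this
  · rintro ⟨c, hc, hc1, hcA⟩ d hd hdA
    have := hd c hc
    rw [dotProduct, Finset.sum_eq_single i₀] at this
    · simpa [hc1] using this
    · intro i _ hi
      by_cases h0 : c i = 0
      · simp [h0]
      · simp [hdA ⟨i, hi⟩ (hcA ⟨i, hi⟩ h0)]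
    · simp

/-- The participants in the support of a word. -/
def participants (i₀ : ι) (c : ι → K) : Set {i : ι // i ≠ i₀} := {i | c i.1 ≠ 0}

/-- Nested supports make the words proportional, and the common value 1 at `i₀` fixes the scalar. -/
theorem IsMinimalCode.eq_of_participants_subset {C : Submodule K (ι → K)}
    (hC : IsMinimalCode C) {i₀ : ι} {c c' : ι → K} (hc : c ∈ C) (hc' : c' ∈ C)
    (h1 : c i₀ = 1) (h1' : c' i₀ = 1) (h : participants i₀ c' ⊆ participants i₀ c) : c' = c := by
  obtain ⟨a, rfl⟩ := hC c hc (fun h0 => by simp [h0] at h1) c' hc' (by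
    intro i hi
    by_cases hi0 : i = i₀
    · subst hi0; simp [h1]
    · exact h (show (⟨i, hi0⟩ : {i : ι // i ≠ i₀}) ∈ _ from hi))
  have : a = 1 := by simpa [h1] using h1'
  simp [this]

theorem IsMinimalCode.injOn_participants {C : Submodule K (ι → K)}
    (hC : IsMinimalCode C) (i₀ : ι) :
    Set.InjOn (participants i₀) {c | c ∈ C ∧ c i₀ = 1} :=
  fun _ hc _ hc' h => hC.eq_of_participants_subset hc'.1 hc.1 hc'.2 hc.2 h.subset

theorem IsMinimalCode.minimalAccessSets_eq [Fintype ι] {k : ℕ} {H : Matrix (Fin k) ι K}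
    {C : Submodule K (ι → K)} (hC : IsMinimalCode C) (hH : IsGeneratorMatrix H (dualCode C))
    (i₀ : ι) :
    minimalAccessSets H i₀ = participants i₀ '' {c | c ∈ C ∧ c i₀ = 1} := by
  ext A
  simp only [minimalAccessSets, Set.mem_ofPred_eq, Set.mem_image, isAccessSet_iff_exists hH]
  constructor
  · rintro ⟨⟨c, hc, hc1, hcA⟩, hmin⟩
    refine ⟨c, ⟨hc, hc1⟩, ?_⟩
    by_contra hne
    exact hmin (participants i₀ c) (Set.ssubset_iff_subset_ne.2 ⟨fun i hi => hcA i hi, hne⟩)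
      ⟨c, hc, hc1, fun _ hi => hi⟩
  · rintro ⟨c, ⟨hc, hc1⟩, rfl⟩
    refine ⟨⟨c, hc, hc1, fun _ hi => hi⟩, ?_⟩
    rintro B hB ⟨c', hc', hc1', hcB⟩
    have hsub : participants i₀ c' ⊆ B := fun i hi => hcB i hi
    have := hC.eq_of_participants_subset hc hc' hc1 hc1' (hsub.trans hB.subset)
    exact hB.not_subset (this ▸ hsub)

theorem IsMinimalCode.ncard_minimalAccessSets [Fintype ι] {k : ℕ} {H : Matrix (Fin k) ι K}
    {C : Submodule K (ι → K)} (hC : IsMinimalCode C) (hH : IsGeneratorMatrix H (dualCode C))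
    (i₀ : ι) :
    (minimalAccessSets H i₀).ncard = {c | c ∈ C ∧ c i₀ = 1}.ncard := by
  rw [hC.minimalAccessSets_eq hH, (hC.injOn_participants i₀).ncard_image]

theorem IsMinimalCode.ncard_minimalAccessSets_mem [Fintype ι] {k : ℕ}
    {H : Matrix (Fin k) ι K} {C : Submodule K (ι → K)} (hC : IsMinimalCode C)
    (hH : IsGeneratorMatrix H (dualCode C)) (i₀ : ι) (x : {i : ι // i ≠ i₀}) :
    {A ∈ minimalAccessSets H i₀ | x ∈ A}.ncard =
      {c | c ∈ C ∧ c i₀ = 1 ∧ c x.1 ≠ 0}.ncard := by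
  have hinj : Set.InjOn (participants i₀) {c | c ∈ C ∧ c i₀ = 1 ∧ c x.1 ≠ 0} :=
    (hC.injOn_participants i₀).mono (by rintro c ⟨h1, h2, -⟩; exact ⟨h1, h2⟩)
  rw [hC.minimalAccessSets_eq hH, ← hinj.ncard_image]
  congr 1
  ext A
  constructor
  · rintro ⟨⟨c, hc, rfl⟩, hx⟩
    exact ⟨c, ⟨hc.1, hc.2, hx⟩, rfl⟩
  · rintro ⟨c, ⟨hc, hc1, hx⟩, rfl⟩
    exact ⟨⟨c, ⟨hc, hc1⟩, rfl⟩, hx⟩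

theorem card_mul_ncard_fiber {M N : Type*} [AddCommGroup M] [AddCommGroup N] [Finite M]
    (f : M →+ N) (hf : Function.Surjective f) (b : N) :
    Nat.card N * {x | f x = b}.ncard = Nat.card M := by
  have h1 : {x | f x = b}.ncard = Nat.card f.ker := by
    obtain ⟨y, rfl⟩ := hf b
    have : {x | f x = f y} = (· + y) '' (f.ker : Set M) := by
      ext x
      simp [← sub_eq_add_neg, sub_eq_zero]
    rw [this, Set.ncard_image_of_injective _ (add_left_injective y)]
    exact (Nat.card_coe_set_eq _).symm
  rw [h1, AddSubgroup.card_eq_card_quotient_mul_card_addSubgroup f.ker,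
    Nat.card_congr (QuotientAddGroup.quotientKerEquivOfSurjective f hf).toEquiv]

theorem card_mul_ncard_eq_one [Finite K] [Finite ι] (C : Submodule K (ι → K)) (i₀ : ι) (h : ∃ c ∈ C, c i₀ ≠ 0) :
    Nat.card K * {c | c ∈ C ∧ c i₀ = 1}.ncard = Nat.card C := by
  have hf : Function.Surjective ((LinearMap.proj i₀ : (ι → K) →ₗ[K] K) ∘ₗ C.subtype) := by
    obtain ⟨c, hc, h0⟩ := h
    intro b
    exact ⟨(b / c i₀) • ⟨c, hc⟩, by simp [h0]⟩
  have := card_mul_ncard_fiber (LinearMap.toAddMonoidHom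
    ((LinearMap.proj i₀ : (ι → K) →ₗ[K] K) ∘ₗ C.subtype)) hf 1
  rw [← this, ← Set.ncard_image_of_injective _ Subtype.val_injective]
  congr 2
  ext c
  simp [and_comm]

/-- The coordinates at `i₀` and `x` are independent functionals on `C`, so they map it onto `K × K`.
The count is the fiber of the first over 1 minus the joint fiber over `(1, 0)`. -/
theorem card_sq_mul_ncard_eq_one_ne_zero [Finite K] [Finite ι]
    (C : Submodule K (ι → K)) (i₀ x : ι)
    (h : ∃ c ∈ C, c i₀ ≠ 0) (hx : ∀ a : K, ¬ ∀ c ∈ C, c x = a * c i₀) :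
    Nat.card K ^ 2 * {c | c ∈ C ∧ c i₀ = 1 ∧ c x ≠ 0}.ncard = (Nat.card K - 1) * Nat.card C := by
  obtain ⟨c, hc, h0⟩ := h
  obtain ⟨d, hd, hdx⟩ := by simpa using hx (c x / c i₀)
  let f : C →ₗ[K] K × K := ((LinearMap.proj i₀ : (ι → K) →ₗ[K] K) ∘ₗ C.subtype).prod
    ((LinearMap.proj x : (ι → K) →ₗ[K] K) ∘ₗ C.subtype)
  have hf : Function.Surjective f := by
    -- Elimination: clear the coordinate `i₀` of `d`; non-proportionality keeps the coordinate `x`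
    -- nonzero.
    let d' : C := ⟨d, hd⟩ - (d i₀ / c i₀) • ⟨c, hc⟩
    have h1 : d'.1 i₀ = 0 := by simp [d', h0]
    have h2 : d'.1 x ≠ 0 := by
      simp only [d', Submodule.coe_sub, Submodule.coe_smul, Pi.sub_apply, Pi.smul_apply,
        smul_eq_mul]
      rw [sub_ne_zero]
      convert hdx using 1
      ring
    rintro ⟨a, b⟩
    refine ⟨(a / c i₀) • ⟨c, hc⟩ + ((b - a / c i₀ * c x) / d'.1 x) • d', ?_⟩
    simp [f, h0, h1, h2]
  have hfib (b : K) : Nat.card K ^ 2 * {c : C | f c = (1, b)}.ncard = Nat.card C := by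
    rw [← card_mul_ncard_fiber f.toAddMonoidHom hf (1, b), Nat.card_prod, sq]
    rfl
  have himage : {c | c ∈ C ∧ c i₀ = 1} ∩ {c | c x = 0} =
      Subtype.val '' {c : C | f c = (1, 0)} := by
    ext c
    simp [f]
    tauto
  have h1 := Set.ncard_inter_add_ncard_sdiff_eq_ncard {c | c ∈ C ∧ c i₀ = 1} {c | c x = 0}
    (Set.toFinite _)
  rw [himage, Set.ncard_image_of_injective _ Subtype.val_injective] at h1
  have hdiff : {c | c ∈ C ∧ c i₀ = 1} \ {c | c x = 0} = {c | c ∈ C ∧ c i₀ = 1 ∧ c x ≠ 0} := by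
    ext c
    simp [and_assoc]
  rw [hdiff] at h1
  have h2 := card_mul_ncard_eq_one C i₀ ⟨c, hc, h0⟩
  rw [Nat.sub_mul, one_mul]
  refine Nat.eq_sub_of_add_eq ?_
  calc _ = Nat.card K ^ 2 * {c | c ∈ C ∧ c i₀ = 1 ∧ c x ≠ 0}.ncard +
        Nat.card K ^ 2 * {c : C | f c = (1, 0)}.ncard := by rw [hfib]
    _ = Nat.card K * (Nat.card K * {c | c ∈ C ∧ c i₀ = 1}.ncard) := by rw [← h1]; ring
    _ = _ := by rw [h2]

/-- Count by coordinates in the support of `u`: where `v i ≠ 0`, exactly one nonzero scalar, `u i /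
v i`, cancels the coordinate, and the term `hammingNorm v` makes up for that loss. -/
theorem sum_hammingNorm_sub_smul [Fintype K] [Fintype ι] [DecidableEq K] {u v : ι → K}
    (h : Function.support v ⊆ Function.support u) :
    ∑ z ∈ Finset.univ.erase (0 : K), hammingNorm (u - z • v) + hammingNorm v =
      (Fintype.card K - 1) * hammingNorm u := by
  simp only [hammingNorm, Finset.card_filter]
  rw [Finset.sum_comm, ← Finset.sum_add_distrib, Finset.mul_sum]
  refine Finset.sum_congr rfl fun i _ => ?_
  by_cases hv : v i = 0
  · by_cases hu : u i = 0 <;> simp [hv, hu]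
  · have hu : u i ≠ 0 := h hv
    have hmem : u i / v i ∈ Finset.univ.erase (0 : K) := by simp [hu, hv]
    rw [← Finset.card_filter, if_pos hv, if_pos hu]
    have : (Finset.univ.erase (0 : K)).filter (fun z => (u - z • v) i ≠ 0) =
        (Finset.univ.erase (0 : K)).erase (u i / v i) := by
      ext z
      simp only [Finset.mem_filter, Finset.mem_erase, Pi.sub_apply, Pi.smul_apply, smul_eq_mul,
        sub_ne_zero, ne_eq, eq_div_iff hv]
      tauto
    rw [this, Finset.card_erase_add_one hmem]
    simp

/-- The Ashikhmin-Barg criterion. -/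
theorem IsMinimalCode.of_hammingNorm_le [Fintype K] [Fintype ι] [DecidableEq K]
    {C : Submodule K (ι → K)} {a b : ℕ} (ha : ∀ c ∈ C, c ≠ 0 → a ≤ hammingNorm c)
    (hb : ∀ c ∈ C, hammingNorm c ≤ b) (hab : (Fintype.card K - 1) * b < Fintype.card K * a) :
    IsMinimalCode C := by
  intro u hu hu0 v hv h
  by_cases hv0 : v = 0
  · exact ⟨0, by simp [hv0]⟩
  by_contra hne
  push Not at hne
  -- If `v` is not a multiple of `u`, no `u - z • v` with `z ≠ 0` vanishes. These weights and that
  -- of `v` are all at least `a`, so `|K| a ≤ (|K| - 1) b`.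
  have h1 : (Fintype.card K - 1) * a ≤
      ∑ z ∈ Finset.univ.erase (0 : K), hammingNorm (u - z • v) := by
    rw [← smul_eq_mul, ← Finset.card_univ, ← Finset.card_erase_of_mem (Finset.mem_univ (0 : K))]
    refine Finset.card_nsmul_le_sum _ _ _ fun z hz => ha _ (C.sub_mem hu (C.smul_mem z hv)) ?_
    intro h0
    rw [sub_eq_zero] at h0
    exact hne z⁻¹ (by rw [h0, inv_smul_smul₀ (Finset.ne_of_mem_erase hz)])
  have h2 := sum_hammingNorm_sub_smul h
  have h3 := ha v hv hv0
  have h4 := Nat.mul_le_mul_left (Fintype.card K - 1) (hb u hu)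
  have h5 : (Fintype.card K - 1) * a + a = Fintype.card K * a := by
    obtain ⟨n, hn⟩ := Nat.exists_eq_succ_of_ne_zero (Fintype.card_ne_zero (α := K))
    rw [hn]
    simp [Nat.succ_mul]
  omega

end LinearCodes

/-! ### Additive characters and Walsh sums. -/

section CharacterSums

variable (p : ℕ) [Fact p.Prime]

theorem stdAddChar_trace_isPrimitive (L : Type*) [Field L] [Finite L] [Algebra (ZMod p) L] :
    ((ZMod.stdAddChar (N := p)).compAddMonoidHom
      (Algebra.trace (ZMod p) L).toAddMonoidHom).IsPrimitive := by
  refine AddChar.IsPrimitive.of_ne_one fun h => ?_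
  obtain ⟨y, hy⟩ := Algebra.trace_surjective (ZMod p) L 1
  have h1 := DFunLike.congr_fun h y
  have h2 : ZMod.stdAddChar (N := p) 1 = ZMod.stdAddChar (N := p) 0 := by
    simpa [hy] using h1
  exact one_ne_zero (ZMod.injective_stdAddChar h2)

theorem sum_stdAddChar_trace {L : Type*} [Field L] [Fintype L] [DecidableEq L]
    [Algebra (ZMod p) L] (b : L) :
    ∑ c : L, (ZMod.stdAddChar (Algebra.trace (ZMod p) L (c * b)) : ℂ) =
      if b = 0 then (Fintype.card L : ℂ) else 0 := by
  have := AddChar.sum_mulShift b (stdAddChar_trace_isPrimitive p L)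
  simpa using this

theorem card_mul_card_zeros {L X : Type*} [Field L] [Fintype L] [DecidableEq L]
    [Algebra (ZMod p) L] [Fintype X] (f : X → L) :
    (Fintype.card L : ℂ) * (Finset.univ.filter fun x => f x = 0).card =
      ∑ c : L, ∑ x, (ZMod.stdAddChar (Algebra.trace (ZMod p) L (c * f x)) : ℂ) := by
  rw [Finset.sum_comm]
  simp only [sum_stdAddChar_trace]
  rw [← Finset.sum_filter, Finset.sum_const, nsmul_eq_mul, mul_comm]

theorem sum_eq_zero_add_sum_units {L : Type*} [Field L] [Fintype L] [DecidableEq L]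
    (f : L → ℂ) : ∑ c, f c = f 0 + ∑ c : Lˣ, f c := by
  rw [← Finset.add_sum_erase _ _ (Finset.mem_univ (0 : L))]
  congr 1
  refine (Finset.sum_bij (fun (c : Lˣ) _ => (c : L)) (by simp) (by simp [Units.ext_iff]) ?_
    (by simp)).symm
  intro b hb
  exact ⟨Units.mk0 b (Finset.ne_of_mem_erase hb), by simp, rfl⟩

theorem component_zero {t : ℕ} {E : Fin t → Type*} {L : Type*} [Field L] [Algebra (ZMod p) L]
    (F : (∀ j, E j) → L) : component p F 0 = 0 := by
  ext x
  simp [component]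

variable {t : ℕ} {E : Fin t → Type*} [∀ j, Field (E j)] [∀ j, Algebra (ZMod p) (E j)]

theorem innerProd_add_right (a x y : ∀ j, E j) :
    innerProd p a (x + y) = innerProd p a x + innerProd p a y := by
  simp [innerProd, mul_add, Finset.sum_add_distrib]

theorem innerProd_comm (a x : ∀ j, E j) : innerProd p a x = innerProd p x a := by
  simp [innerProd, mul_comm]

variable [∀ j, Fintype (E j)]

theorem exists_innerProd_eq_one {a : ∀ j, E j} (ha : a ≠ 0) : ∃ x, innerProd p a x = 1 := by
  classical
  obtain ⟨j, hj⟩ := Function.ne_iff.1 ha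
  obtain ⟨y, hy⟩ := Algebra.trace_surjective (ZMod p) (E j) 1
  refine ⟨Pi.single j ((a j)⁻¹ * y), ?_⟩
  rw [innerProd, Finset.sum_eq_single j]
  · rw [Pi.single_eq_same, mul_inv_cancel_left₀ hj, hy]
  · intro i _ hi
    simp [hi]
  · simp

theorem walsh_zero_zero : walsh p (0 : (∀ j, E j) → ZMod p) 0 = Fintype.card (∀ j, E j) := by
  simp [walsh, innerProd]

theorem walsh_zero_of_ne_zero {a : ∀ j, E j} (ha : a ≠ 0) :
    walsh p (0 : (∀ j, E j) → ZMod p) a = 0 := by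
  let g : (∀ j, E j) →+ ZMod p :=
    { toFun := fun x => 0 - innerProd p a x
      map_zero' := by simp [innerProd]
      map_add' := fun x y => by rw [innerProd_add_right]; ring }
  have h : (ZMod.stdAddChar (N := p)).compAddMonoidHom g ≠ 1 := by
    intro h
    obtain ⟨x, hx⟩ := exists_innerProd_eq_one p ha
    have h1 : ZMod.stdAddChar (N := p) (g x) = ZMod.stdAddChar (N := p) 0 := by
      simpa using DFunLike.congr_fun h x
    have h2 : g x = -1 := by simp [g, hx]
    rw [h2] at h1
    exact one_ne_zero (neg_eq_zero.1 (ZMod.injective_stdAddChar h1))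
  exact AddChar.sum_eq_zero_of_ne_one h

end CharacterSums

/-! ### Zeros of words as sums of Walsh values. -/

section Words

variable (p : ℕ) [Fact p.Prime] (K : Type*) [Field K] [Algebra (ZMod p) K]
  {L : Type*} [Field L] [Algebra (ZMod p) L] [Algebra K L]
  [IsScalarTower (ZMod p) K L]
  {t : ℕ} {E : Fin t → Type*} [∀ j, Field (E j)]
  [∀ j, Algebra (ZMod p) (E j)] [∀ j, Algebra K (E j)] [∀ j, IsScalarTower (ZMod p) K (E j)]

/-- The codeword `c_{α,β}`, extended to the whole space. -/
noncomputable def word {L : Type*} [Field L] [Algebra K L] (F : (∀ j, E j) → L) (α : L) (β x : ∀ j, E j) : K :=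
  Algebra.trace K L (α * F x) - ∑ j, Algebra.trace K (E j) (β j * x j)

/-- Transitivity of the trace: each additive character of `K` applied to a word becomes a Walsh
summand with rescaled parameters. -/
theorem trace_mul_word [Finite K] [Finite L] [∀ j, Finite (E j)]
    (F : (∀ j, E j) → L) (α : L) (β x : ∀ j, E j) (z : K) :
    Algebra.trace (ZMod p) K (z * word K F α β x) =
      component p F (z • α) x - innerProd p (z • β) x := by
  simp only [word, component, innerProd, mul_sub, Finset.mul_sum, map_sub, map_sum]
  simp only [← smul_eq_mul z, ← map_smul, Algebra.trace_trace, smul_mul_assoc, Pi.smul_apply]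

variable [Fintype K] [DecidableEq K] [Finite L] [∀ j, Fintype (E j)]

theorem card_mul_card_word_zeros (F : (∀ j, E j) → L) (α : L) (β : ∀ j, E j) :
    (Fintype.card K : ℂ) * (Finset.univ.filter fun x => word K F α β x = 0).card =
      ∑ z : K, walsh p (component p F (z • α)) (z • β) := by
  rw [card_mul_card_zeros p]
  simp only [trace_mul_word, walsh]

/-- The number of zeros of a nonzero word deviates from `|V| / |K|` by less than `√|V|`. -/
theorem norm_card_word_zeros_sub_le {F : (∀ j, E j) → L} (hF : IsVectorialBent p F) {α : L}
    {β : ∀ j, E j} (h : α ≠ 0 ∨ β ≠ 0) :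
    ‖((Fintype.card K : ℂ) * (Finset.univ.filter fun x => word K F α β x = 0).card -
      Fintype.card (∀ j, E j) : ℂ)‖ ≤ (Fintype.card K - 1 : ℕ) * sqrtCard E := by
  rw [card_mul_card_word_zeros p, sum_eq_zero_add_sum_units, zero_smul, zero_smul, component_zero,
    walsh_zero_zero, add_sub_cancel_left]
  refine (norm_sum_le _ _).trans ?_
  rw [← Fintype.card_units, ← nsmul_eq_mul, ← Finset.card_univ]
  refine Finset.sum_le_card_nsmul _ _ _ fun z _ => ?_
  -- For `α = 0` the summand is a nontrivial linear character, with sum zero; otherwise bentness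
  -- gives the exact modulus.
  by_cases hα : α = 0
  · have hβ : (z : K) • β ≠ 0 := smul_ne_zero z.ne_zero (h.resolve_left (not_not.2 hα))
    rw [hα, smul_zero, component_zero, walsh_zero_of_ne_zero p hβ, norm_zero]
    exact Real.sqrt_nonneg _
  · exact (hF _ (smul_ne_zero z.ne_zero hα) _).le

end Words

/-! ### Zeros of a function with a vectorial dual. -/

section Zeros

variable (p : ℕ) [Fact p.Prime] {t : ℕ} {E : Fin t → Type*} [∀ j, Field (E j)]
  [∀ j, Fintype (E j)] [∀ j, Algebra (ZMod p) (E j)]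
  {L : Type*} [Field L] [Fintype L] [DecidableEq L] [Algebra (ZMod p) L]

/-- The zeros of `F` are counted by the value at `0` of a vectorial dual. -/
theorem card_mul_card_zeros_of_dual {F Fstar : (∀ j, E j) → L} {ε : ℤ} {σ : Equiv.Perm Lˣ}
    (h : ∀ c : Lˣ, IsWeaklyRegularWith p ε (component p F c) (component p Fstar (σ c : L))) :
    (Fintype.card L : ℂ) * (Finset.univ.filter fun x => F x = 0).card =
      Fintype.card (∀ j, E j) + ε * sqrtCard E *
        ((if Fstar 0 = 0 then (Fintype.card L : ℂ) else 0) - 1) := by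
  rw [card_mul_card_zeros p, sum_eq_zero_add_sum_units]
  congr 1
  · simp
  · have h1 (c : Lˣ) : ∑ x, (ZMod.stdAddChar (Algebra.trace (ZMod p) L (c * F x)) : ℂ) =
        ε * sqrtCard E * ZMod.stdAddChar (Algebra.trace (ZMod p) L ((σ c : L) * Fstar 0)) := by
      rw [show ZMod.stdAddChar (Algebra.trace (ZMod p) L ((σ c : L) * Fstar 0)) =
        ZMod.stdAddChar (component p Fstar (σ c : L) 0) from rfl, ← h c 0]
      simp [walsh, component, innerProd]
    simp only [h1]
    -- As `σ` permutes the nonzero scalars it can be dropped; completing the sum by `c = 0` accounts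
    -- for the `-1`.
    rw [← Finset.mul_sum, Equiv.sum_comp σ fun c : Lˣ =>
      (ZMod.stdAddChar (Algebra.trace (ZMod p) L ((c : L) * Fstar 0)) : ℂ),
      ← sum_stdAddChar_trace p (Fstar 0), sum_eq_zero_add_sum_units fun c : L =>
      (ZMod.stdAddChar (Algebra.trace (ZMod p) L (c * Fstar 0)) : ℂ)]
    simp

end Zeros

/-! ### Weights, minimality and size of the code. -/

section Weights

variable (K : Type*) [Field K]

theorem codeword_eq_word {L : Type*} [Field L] [Algebra K L]
    {t : ℕ} {E : Fin t → Type*} [∀ j, Field (E j)] [∀ j, Algebra K (E j)]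
    (F : (∀ j, E j) → L) (α : L)
    (β : ∀ j, E j) (x : {x : ∀ j, E j // x ≠ 0}) : codeword K F α β x = word K F α β x.1 := rfl

theorem codeword_sub {L : Type*} [Field L] [Algebra K L]
    {t : ℕ} {E : Fin t → Type*} [∀ j, Field (E j)] [∀ j, Algebra K (E j)]
    (F : (∀ j, E j) → L) (α α' : L)
    (β β' : ∀ j, E j) :
    codeword K F (α - α') (β - β') = codeword K F α β - codeword K F α' β' := by
  ext x
  simp only [codeword, Pi.sub_apply, sub_mul, map_sub, Finset.sum_sub_distrib]
  ring

/-- The words with `α = 0` suffice, by nondegeneracy of the trace form. -/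
theorem exists_mem_codeCF_ne_zero (p : ℕ) [Fact p.Prime] [Algebra (ZMod p) K] [Finite K]
    {L : Type*} [Field L] [Finite L] [Algebra (ZMod p) L] [Algebra K L]
    [IsScalarTower (ZMod p) K L] {t : ℕ} {E : Fin t → Type*} [∀ j, Field (E j)]
    [∀ j, Fintype (E j)] [∀ j, Algebra (ZMod p) (E j)] [∀ j, Algebra K (E j)]
    [∀ j, IsScalarTower (ZMod p) K (E j)] (F : (∀ j, E j) → L)
    (x : {x : ∀ j, E j // x ≠ 0}) : ∃ c ∈ codeCF K F, c x ≠ 0 := by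
  obtain ⟨β, hβ⟩ := exists_innerProd_eq_one p x.2
  refine ⟨codeword K F 0 β, ⟨0, β, rfl⟩, fun h => ?_⟩
  have := trace_mul_word p K F 0 β x.1 1
  rw [← codeword_eq_word, h, mul_zero, map_zero, one_smul, one_smul, component_zero,
    innerProd_comm, hβ] at this
  simp at this

/-- Omitting the coordinate `x = 0` loses no weight, as every word vanishes there when `F 0 = 0`. -/
theorem hammingNorm_codeword_add_card_zeros [DecidableEq K] {L : Type*} [Field L]
    [Algebra K L] {t : ℕ} {E : Fin t → Type*} [∀ j, Field (E j)] [∀ j, Algebra K (E j)]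
    [∀ j, Fintype (E j)] [∀ j, DecidableEq (E j)] {F : (∀ j, E j) → L}
    (h0 : F 0 = 0) (α : L) (β : ∀ j, E j) :
    hammingNorm (codeword K F α β) + (Finset.univ.filter fun x => word K F α β x = 0).card =
      Fintype.card (∀ j, E j) := by
  have h1 : hammingNorm (codeword K F α β) =
      (Finset.univ.filter fun x => word K F α β x ≠ 0).card := by
    rw [hammingNorm, ← Finset.card_map (Function.Embedding.subtype _)]
    congr 1
    ext x
    simp only [Finset.mem_map, Finset.mem_filter, Finset.mem_univ, true_and,
      Function.Embedding.subtype_apply, Subtype.exists, exists_and_right, exists_eq_right,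
      codeword_eq_word]
    refine ⟨fun ⟨_, h⟩ => (Finset.mem_filter.1 h).2, fun h =>
      ⟨?_, Finset.mem_filter.2 ⟨Finset.mem_univ _, h⟩⟩⟩
    rintro rfl
    exact h (by simp [word, h0])
  rw [h1, add_comm, Finset.card_filter_add_card_filter_not, Finset.card_univ]

variable (p : ℕ) [Fact p.Prime] [Algebra (ZMod p) K]
  {L : Type*} [Field L] [Algebra (ZMod p) L] [Algebra K L] [IsScalarTower (ZMod p) K L]
  {t : ℕ} {E : Fin t → Type*} [∀ j, Field (E j)]
  [∀ j, Algebra (ZMod p) (E j)] [∀ j, Algebra K (E j)] [∀ j, IsScalarTower (ZMod p) K (E j)]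
  [Fintype K] [DecidableEq K] [∀ j, Fintype (E j)] [∀ j, DecidableEq (E j)]

theorem hammingNorm_codeword_bounds [Finite L] {F : (∀ j, E j) → L} (hF : IsVectorialBent p F)
    (h0 : F 0 = 0) {Q w : ℕ} (hQ : Fintype.card (∀ j, E j) = Q ^ 2)
    (hw : Q = Fintype.card K * w) {α : L} {β : ∀ j, E j} (h : α ≠ 0 ∨ β ≠ 0) :
    (Fintype.card K - 1) * ((Q - 1) * w) ≤ hammingNorm (codeword K F α β) ∧
      hammingNorm (codeword K F α β) ≤ (Fintype.card K - 1) * ((Q + 1) * w) := by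
  have h1 := norm_card_word_zeros_sub_le p K hF h
  have h2 := hammingNorm_codeword_add_card_zeros K h0 α β
  have hs : sqrtCard E = Q := by rw [sqrtCard, hQ]; simp
  rw [hs, hQ] at h1
  rw [hQ] at h2
  generalize hammingNorm (codeword K F α β) = W at h2 ⊢
  generalize (Finset.univ.filter fun x => word K F α β x = 0).card = N at h1 h2
  have hQ0 : Q ≠ 0 := by
    rintro rfl
    exact Fintype.card_ne_zero (hQ.trans (by norm_num))
  obtain ⟨k, hk⟩ := Nat.exists_eq_succ_of_ne_zero (Fintype.card_ne_zero (α := K))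
  obtain ⟨Q, rfl⟩ := Nat.exists_eq_succ_of_ne_zero hQ0
  rw [hk] at h1 hw ⊢
  simp only [Nat.succ_eq_add_one, Nat.add_sub_cancel] at *
  have h3 : |(k + 1 : ℤ) * N - (Q + 1 : ℤ) ^ 2| ≤ (k : ℤ) * (Q + 1) := by
    have e : (((k + 1 : ℕ) : ℂ) * N - ((Q + 1) ^ 2 : ℕ) : ℂ) =
        (((k + 1 : ℤ) * N - (Q + 1 : ℤ) ^ 2 : ℤ) : ℂ) := by push_cast; ring
    rw [e, Complex.norm_intCast] at h1
    rw [← Int.cast_le (R := ℝ)]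
    push_cast at h1 ⊢
    exact h1
  rw [abs_le] at h3
  zify at h2 hw ⊢
  have hN : (N : ℤ) = (Q + 1) ^ 2 - W := by linarith
  rw [hN] at h3
  have hk0 : (0 : ℤ) < k + 1 := by positivity
  constructor
  · refine le_of_mul_le_mul_left ?_ hk0
    have : (k + 1 : ℤ) * (k * (Q * w)) = k * Q * (Q + 1) := by rw [hw]; ring
    rw [this]
    linarith [h3.2]
  · refine le_of_mul_le_mul_left ?_ hk0
    have : (k + 1 : ℤ) * (k * ((Q + 1 + 1) * w)) = k * (Q + 2) * (Q + 1) := by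
      rw [show (k + 1 : ℤ) * (k * ((Q + 1 + 1) * w)) = k * (Q + 2) * ((k + 1) * w) by ring, ← hw]
    rw [this]
    linarith [h3.1]

/-- Positivity of the weight makes the parametrization injective; weight above 1 keeps unit vectors
out of the code. -/
theorem two_lt_hammingNorm_codeword [Finite L] {F : (∀ j, E j) → L}
    (hF : IsVectorialBent p F) (h0 : F 0 = 0) {Q w : ℕ} (hQ : Fintype.card (∀ j, E j) = Q ^ 2)
    (hw : Q = Fintype.card K * w) (hQK : 3 * Fintype.card K ≤ Q)
    {α : L} {β : ∀ j, E j} (h : α ≠ 0 ∨ β ≠ 0) :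
    2 < hammingNorm (codeword K F α β) := by
  refine lt_of_lt_of_le ?_ (hammingNorm_codeword_bounds K p hF h0 hQ hw h).1
  have hk := Fintype.one_lt_card (α := K)
  have h1 : 1 ≤ Fintype.card K - 1 := by omega
  have h2 : 3 ≤ Q - 1 := by omega
  have h3 : 1 ≤ w := by
    rcases Nat.eq_zero_or_pos w with rfl | h
    · omega
    · exact h
  calc 2 < 1 * (3 * 1) := by norm_num
    _ ≤ _ := by gcongr

theorem isMinimalCode_codeCF [Finite L] {F : (∀ j, E j) → L}
    (hF : IsVectorialBent p F) (h0 : F 0 = 0) {Q w : ℕ} (hQ : Fintype.card (∀ j, E j) = Q ^ 2)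
    (hw : Q = Fintype.card K * w) (hQK : 3 * Fintype.card K ≤ Q) :
    IsMinimalCode (codeCF K F) := by
  have hk := Fintype.one_lt_card (α := K)
  have h3 : 0 < w := by
    rcases Nat.eq_zero_or_pos w with rfl | h
    · omega
    · exact h
  refine IsMinimalCode.of_hammingNorm_le (a := (Fintype.card K - 1) * ((Q - 1) * w))
    (b := (Fintype.card K - 1) * ((Q + 1) * w)) ?_ ?_ ?_
  · rintro _ ⟨α, β, rfl⟩ hne
    refine (hammingNorm_codeword_bounds K p hF h0 hQ hw ?_).1
    by_contra! h
    exact hne (by rw [h.1, h.2]; ext x; simp [codeword])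
  · rintro _ ⟨α, β, rfl⟩
    by_cases h : α ≠ 0 ∨ β ≠ 0
    · exact (hammingNorm_codeword_bounds K p hF h0 hQ hw h).2
    · push Not at h
      have : codeword K F α β = 0 := by rw [h.1, h.2]; ext x; simp [codeword]
      simp [this]
  · obtain ⟨k, hk'⟩ : ∃ k, Fintype.card K = k + 2 := ⟨Fintype.card K - 2, by omega⟩
    obtain ⟨Q, rfl⟩ : ∃ Q', Q = Q' + 1 := ⟨Q - 1, by omega⟩
    rw [hk'] at hQK ⊢
    simp only [Nat.add_sub_cancel, show k + 2 - 1 = k + 1 by omega]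
    -- With `|K| = k + 2` and `Q` lowered by one, this is the ratio condition `(|K| - 1)(Q + 1) <
    -- |K|(Q - 1)`, that is `2|K| < Q + 1`.
    have : (k + 1) * (Q + 1 + 1) < (k + 2) * Q := by nlinarith
    calc (k + 1) * ((k + 1) * ((Q + 1 + 1) * w)) = (k + 1) * w * ((k + 1) * (Q + 1 + 1)) := by ring
      _ < (k + 1) * w * ((k + 2) * Q) := by gcongr
      _ = _ := by ring

theorem card_codeCF [Fintype L] {F : (∀ j, E j) → L}
    (hF : IsVectorialBent p F) (h0 : F 0 = 0) {Q w : ℕ} (hQ : Fintype.card (∀ j, E j) = Q ^ 2)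
    (hw : Q = Fintype.card K * w) (hQK : 3 * Fintype.card K ≤ Q) :
    Nat.card (codeCF K F) = Fintype.card L * Fintype.card (∀ j, E j) := by
  let f : L × (∀ j, E j) → codeCF K F := fun a => ⟨codeword K F a.1 a.2, a.1, a.2, rfl⟩
  have hf : Function.Bijective f := by
    constructor
    · rintro ⟨α, β⟩ ⟨α', β'⟩ h
      have h1 : codeword K F α β = codeword K F α' β' := congrArg Subtype.val h
      by_contra hne
      have h2 : α - α' ≠ 0 ∨ β - β' ≠ 0 := by
        by_contra! h
        exact hne (Prod.ext (sub_eq_zero.1 h.1) (sub_eq_zero.1 h.2))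
      have := two_lt_hammingNorm_codeword K p hF h0 hQ hw hQK h2
      rw [codeword_sub, h1, sub_self] at this
      simp at this
    · rintro ⟨_, α, β, rfl⟩
      exact ⟨(α, β), rfl⟩
  rw [← Nat.card_congr (Equiv.ofBijective f hf), Nat.card_prod, Nat.card_eq_fintype_card,
    Nat.card_eq_fintype_card]

theorem two_le_minDist_dualCode [Finite L] {F : (∀ j, E j) → L}
    (hF : IsVectorialBent p F) (h0 : F 0 = 0) {Q w : ℕ} (hQ : Fintype.card (∀ j, E j) = Q ^ 2)
    (hw : Q = Fintype.card K * w) (hQK : 3 * Fintype.card K ≤ Q) :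
    2 ≤ minDist (dualCode (codeCF K F)) := by
  have hQ3 : 3 ≤ Q := by
    have := Fintype.card_pos (α := K)
    omega
  have hV : Nontrivial (∀ j, E j) := by
    rw [← Fintype.one_lt_card_iff_nontrivial, hQ]
    exact Nat.one_lt_pow (by norm_num) (by omega)
  obtain ⟨x₀, hx₀⟩ := exists_ne (0 : ∀ j, E j)
  -- The dual must be shown nonzero, since the zero code has the junk distance 0; it suffices that
  -- `C_F` is not the whole space.
  have hsingle : Pi.single ⟨x₀, hx₀⟩ (1 : K) ∉ codeCF K F := by
    rintro ⟨α, β, h⟩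
    have hle : hammingNorm (codeword K F α β) ≤ 1 := by
      rw [← h, hammingNorm, Finset.card_le_one]
      intro a ha b hb
      simp only [Finset.mem_filter, Finset.mem_univ, true_and, ne_eq, Pi.single_apply,
        ite_eq_right_iff, one_ne_zero, imp_false, not_not] at ha hb
      rw [ha, hb]
    have hne : α ≠ 0 ∨ β ≠ 0 := by
      by_contra! h'
      have := congrFun h ⟨x₀, hx₀⟩
      rw [h'.1, h'.2] at this
      simp [codeword] at this
    have := two_lt_hammingNorm_codeword K p hF h0 hQ hw hQK hne
    omega
  obtain ⟨d, hd, hd0⟩ := exists_mem_dualCode_of_notMem hsingle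
  refine le_csInf ⟨_, d, hd, fun h => hd0 (by simp [h]), rfl⟩ ?_
  rintro _ ⟨d, hd, hd0, rfl⟩
  by_contra! hlt
  obtain ⟨i, hi⟩ := Function.ne_iff.1 hd0
  have huniq : ∀ j, j ≠ i → d j = 0 := by
    intro j hj
    by_contra hj0
    exact hj (Finset.card_le_one.1 (Nat.le_of_lt_succ hlt) j (by simpa using hj0) i
      (by simpa using hi))
  obtain ⟨c, hc, hci⟩ := exists_mem_codeCF_ne_zero K p F i
  have := hd c hc
  rw [dotProduct, Finset.sum_eq_single i (fun j _ hj => by rw [huniq j hj, zero_mul])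
    (by simp)] at this
  exact (mul_ne_zero hi hci) this

end Weights

/-! ### Dual words of weight two. -/

section DualDistance

variable {K : Type*} [Field K] [DecidableEq K] {L : Type*} [Field L] [Algebra K L]
  {t : ℕ} {E : Fin t → Type*} [∀ j, Field (E j)] [∀ j, Algebra K (E j)]
  [∀ j, Fintype (E j)] [∀ j, DecidableEq (E j)]

theorem minDist_dualCode_le_two (h2 : (2 : K) ≠ 0) {F : (∀ j, E j) → L}
    (hneg : ∀ x, F (-x) = F x) {y : ∀ j, E j} (hy : y ≠ 0) (hFy : F y = 0) :
    minDist (dualCode (codeCF K F)) ≤ 2 := by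
  let a : {x : ∀ j, E j // x ≠ 0} := ⟨y, hy⟩
  let b : {x : ∀ j, E j // x ≠ 0} := ⟨-y, neg_ne_zero.2 hy⟩
  let d : {x : ∀ j, E j // x ≠ 0} → K := Pi.single a 1 + Pi.single b 1
  have hd : d ∈ dualCode (codeCF K F) := by
    rintro _ ⟨α, β, rfl⟩
    simp only [d, add_dotProduct, single_one_dotProduct]
    simp [codeword, a, b, hneg, hFy]
  have hd0 : d ≠ 0 := by
    intro h
    have := congrFun h a
    simp only [d, Pi.add_apply, Pi.single_eq_same, Pi.single_apply, Pi.zero_apply] at this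
    -- If `a = b` the entry is `2`, so `2 ≠ 0` covers this case without proving `y ≠ -y`.
    split_ifs at this
    · exact h2 (by rw [← this]; norm_num)
    · simp at this
  have hle : minDist (dualCode (codeCF K F)) ≤ hammingNorm d := csInf_le' ⟨d, hd, hd0, rfl⟩
  refine hle.trans ?_
  refine (Finset.card_le_card (t := {a, b}) ?_).trans Finset.card_le_two
  intro x hx
  by_contra hx'
  simp only [Finset.mem_insert, Finset.mem_singleton, not_or] at hx'
  simp [d, hx'.1, hx'.2] at hx

end DualDistance

/-! ### Nontrivial zeros of `F`. -/

section ConditionA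

variable {p m t : ℕ} [Fact p.Prime] {r : Fin t → ℕ} {L : Type*} {E : Fin t → Type*}
  [Field L] [Fintype L] [∀ j, Field (E j)] [∀ j, Fintype (E j)]
  [Algebra (ZMod p) L] [∀ j, Algebra (ZMod p) (E j)] [∀ j, Algebra L (E j)]
  {F : (∀ j, E j) → L} {ε : ℤ}

theorem ConditionA.card_pi (hF : ConditionA p m r F ε) :
    Fintype.card (∀ j, E j) = (p ^ ((∑ j, r j) / 2)) ^ 2 := by
  classical
  rw [← pow_mul, Nat.div_mul_cancel hF.even_r.two_dvd, Fintype.card_pi,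
    Finset.prod_congr rfl fun j _ => hF.card_E j, Finset.prod_pow_eq_pow_sum]

theorem ConditionA.isVectorialBent (hF : ConditionA p m r F ε) : IsVectorialBent p F := by
  obtain ⟨_, _, _, -, -, -, h, -⟩ := hF.dual
  exact h.1

/-- Outside of the exceptional case `F` has a nontrivial zero. -/
theorem ConditionA.exists_ne_zero_map_eq_zero (hF : ConditionA p m r F ε)
    (hm : ¬ (ε = -1 ∧ m = (∑ j, r j) / 2)) : ∃ y, y ≠ 0 ∧ F y = 0 := by
  classical
  by_contra! hne
  obtain ⟨Fstar, _, σ, -, -, -, -, h, -⟩ := hF.dual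
  have h1 := card_mul_card_zeros_of_dual p h
  have h2 : (Finset.univ.filter fun x => F x = 0).card = 1 := by
    rw [Finset.card_eq_one]
    refine ⟨0, ?_⟩
    ext x
    simp only [Finset.mem_filter, Finset.mem_univ, true_and, Finset.mem_singleton]
    refine ⟨fun hx => ?_, fun hx => hx ▸ hF.map_zero⟩
    by_contra hx0
    exact hne x hx0 hx
  have hp := (Fact.out : p.Prime).two_le
  have hp3 : 3 ≤ p := by have := hF.p_odd; omega
  have hs : sqrtCard E = ((p ^ ((∑ j, r j) / 2) : ℕ) : ℝ) := by
    rw [sqrtCard, hF.card_pi]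
    simp
  rw [h2, hF.card_L, hs, hF.card_pi] at h1
  have hle : p ^ m ≤ p ^ ((∑ j, r j) / 2) := Nat.pow_le_pow_right (by omega) hF.m_le
  have hinj : p ^ m = p ^ ((∑ j, r j) / 2) → m = (∑ j, r j) / 2 := fun h =>
    Nat.pow_right_injective hp h
  have hM : 3 ≤ p ^ m := hp3.trans (Nat.le_self_pow hF.m_pos.ne' p)
  generalize p ^ m = M at h1 hle hinj hM
  generalize p ^ ((∑ j, r j) / 2) = Q at h1 hle hinj
  -- The zero count if `0` were the only zero. With `3 ≤ M ≤ Q`, it fails on size except for `Fstar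
  -- 0 = 0`, `ε = -1`, where it reads `(Q + 1)(Q - M) = 0`, the excluded case `M = Q`.
  have h3 : (M : ℤ) = Q ^ 2 + ε * Q * ((if Fstar 0 = 0 then (M : ℤ) else 0) - 1) := by
    rw [← Int.cast_inj (α := ℂ)]
    split_ifs at h1 ⊢ <;> push_cast at h1 ⊢ <;> simpa using h1
  zify at hle hM
  split_ifs at h3 <;> rcases hF.sign with rfl | rfl
  · nlinarith
  · refine hm ⟨rfl, hinj ?_⟩
    have : ((Q : ℤ) + 1) * (Q - M) = 0 := by linarith
    rcases mul_eq_zero.1 this with h | h <;> omega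
  · nlinarith
  · nlinarith

end ConditionA

end VDBCode

theorem proposition3
    {p m s t : ℕ} [Fact p.Prime] {r : Fin t → ℕ}
    {K L : Type*} {E : Fin t → Type*}
    [Field K] [Fintype K] [DecidableEq K]
    [Field L] [Fintype L]
    [∀ j, Field (E j)] [∀ j, Fintype (E j)] [∀ j, DecidableEq (E j)]
    [Algebra (ZMod p) L] [∀ j, Algebra (ZMod p) (E j)]
    [Algebra K L] [∀ j, Algebra L (E j)] [∀ j, Algebra K (E j)]
    [∀ j, IsScalarTower K L (E j)]
    (F : (∀ j, E j) → L) (ε : ℤ)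
    (hF : VDBCode.ConditionA p m r F ε)
    (hs : s ∣ m) (hK : Fintype.card K = p ^ s)
    (hsr : s ≤ (∑ j, r j) / 2 - 1) :
    VDBCode.IsMinimalCode (VDBCode.codeCF K F) ∧
    2 ≤ VDBCode.minDist (VDBCode.dualCode (VDBCode.codeCF K F)) ∧
    (¬ (ε = -1 ∧ m = (∑ j, r j) / 2) →
      VDBCode.minDist (VDBCode.dualCode (VDBCode.codeCF K F)) = 2) ∧
    ∀ (k k' : ℕ) (G : Matrix (Fin k) {x : ∀ j, E j // x ≠ 0} K)
      (H : Matrix (Fin k') {x : ∀ j, E j // x ≠ 0} K),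
      VDBCode.IsGeneratorMatrix G (VDBCode.codeCF K F) →
      VDBCode.IsGeneratorMatrix H (VDBCode.dualCode (VDBCode.codeCF K F)) →
      ∀ x₀ : {x : ∀ j, E j // x ≠ 0},
        (VDBCode.minimalAccessSets H x₀).ncard = p ^ ((∑ j, r j) + m - s) ∧
        ∀ x : {x : {x : ∀ j, E j // x ≠ 0} // x ≠ x₀},
          ((∃ a : K, G.col x.1 = a • G.col x₀) →
            ∀ A ∈ VDBCode.minimalAccessSets H x₀, x ∈ A) ∧
          ((¬ ∃ a : K, G.col x.1 = a • G.col x₀) →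
            {A ∈ VDBCode.minimalAccessSets H x₀ | x ∈ A}.ncard =
              (p ^ s - 1) * p ^ ((∑ j, r j) + m - 2 * s)) := by
  classical
  have : CharP L p := charP_of_injective_algebraMap (algebraMap (ZMod p) L).injective p
  have : CharP K p := (algebraMap K L).charP (algebraMap K L).injective p
  -- The towers over the prime field commute because ring homomorphisms out of `ZMod p` are unique.
  let : Algebra (ZMod p) K := ZMod.algebra K p
  have : IsScalarTower (ZMod p) K L := IsScalarTower.of_algebraMap_eq' (Subsingleton.elim _ _)
  have (j : Fin t) : IsScalarTower (ZMod p) K (E j) :=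
    IsScalarTower.of_algebraMap_eq' (Subsingleton.elim _ _)
  have hp3 : 3 ≤ p := by
    have := (Fact.out : p.Prime).two_le
    have := hF.p_odd
    omega
  have hrpos := hF.four_le
  have hsm : s ≤ m := Nat.le_of_dvd hF.m_pos hs
  have hmr := hF.m_le
  have hw : p ^ ((∑ j, r j) / 2) = Fintype.card K * p ^ ((∑ j, r j) / 2 - s) := by
    rw [hK, ← pow_add]
    congr 1
    omega
  have hQK : 3 * Fintype.card K ≤ p ^ ((∑ j, r j) / 2) := by
    rw [hK]
    calc 3 * p ^ s ≤ p * p ^ s := by gcongr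
      _ = p ^ (s + 1) := by ring
      _ ≤ _ := Nat.pow_le_pow_right (by omega) (by omega)
  have hbent := hF.isVectorialBent
  have hmin := VDBCode.isMinimalCode_codeCF K p hbent hF.map_zero hF.card_pi hw hQK
  have hdist := VDBCode.two_le_minDist_dualCode K p hbent hF.map_zero hF.card_pi hw hQK
  have hcard : Nat.card (VDBCode.codeCF K F) = p ^ (∑ j, r j + m) := by
    rw [VDBCode.card_codeCF K p hbent hF.map_zero hF.card_pi hw hQK, hF.card_L, hF.card_pi,
      ← pow_mul, Nat.div_mul_cancel hF.even_r.two_dvd, ← pow_add, add_comm]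
  have h2 : (2 : K) ≠ 0 := by
    intro h
    have := Nat.le_of_dvd (by norm_num) ((CharP.cast_eq_zero_iff K p 2).1 (by exact_mod_cast h))
    omega
  refine ⟨hmin, hdist, fun hne => ?_, ?_⟩
  · obtain ⟨y, hy, hFy⟩ := hF.exists_ne_zero_map_eq_zero hne
    exact le_antisymm (VDBCode.minDist_dualCode_le_two h2 hF.map_neg hy hFy) hdist
  · intro k k' G H hG hH x₀
    have hx₀ := VDBCode.exists_mem_codeCF_ne_zero K p F x₀
    have hpos : 0 < p ^ s := by positivity
    refine ⟨?_, fun x => ⟨?_, fun hx => ?_⟩⟩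
    · have := VDBCode.card_mul_ncard_eq_one _ x₀ hx₀
      rw [hcard, Nat.card_eq_fintype_card, hK] at this
      rw [hmin.ncard_minimalAccessSets hH]
      refine Nat.eq_of_mul_eq_mul_left hpos ?_
      rw [this, ← pow_add]
      congr 1
      omega
    · rintro ⟨a, ha⟩ A hA
      rw [hmin.minimalAccessSets_eq hH] at hA
      obtain ⟨c, ⟨hc, hc1⟩, rfl⟩ := hA
      have hcol := (hG.col_eq_smul_iff _ _ _).1 ha
      obtain ⟨d, hd, hdx⟩ := VDBCode.exists_mem_codeCF_ne_zero K p F x.1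
      -- The coordinate at `x` is not identically zero on the code, which forces `a ≠ 0`.
      rw [hcol d hd] at hdx
      change c x.1 ≠ 0
      rw [hcol c hc, hc1, mul_one]
      exact left_ne_zero_of_mul hdx
    · have := VDBCode.card_sq_mul_ncard_eq_one_ne_zero _ x₀ x.1 hx₀ fun a ha =>
        hx ⟨a, (hG.col_eq_smul_iff _ _ _).2 ha⟩
      rw [hcard, Nat.card_eq_fintype_card, hK] at this
      rw [hmin.ncard_minimalAccessSets_mem hH]
      refine Nat.eq_of_mul_eq_mul_left (pow_pos hpos 2) ?_
      rw [this, mul_left_comm, ← pow_mul, ← pow_add]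
      congr 2
      omega
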